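/- **Setting.** There are finitely many clients; client $i$ holds a finite local dataset $D_i$ of distinct records, and $\mathcal D=(D_i)_i$ is the federated dataset. For a record $d=d_{i,j}\in D_i$ let $D_{i,-j}=D_i\setminus\{d\}$, and let $\mathcal D_{-i,j}$ be $\mathcal D$ with $D_i$ replaced by $D_{i,-j}$. For $\alpha>1$ and probability measures $P,Q$ let $D_\alpha(P\|Q)=\frac1{\alpha-1}\ln\int\left(\frac{dP}{dQ}\right)^\alpha dQ$ if $P\ll Q$, and $D_\alpha(P\|Q)=+\infty$ otherwise. A randomized algorithm $\mathcal A$ on local datasets of client $i$ (resp. on federated datasets) is $(\alpha,\rho)$-RDP with respect to $d_{i,j}$ if $\max\{D_\alpha(\mathcal A(D)\|\mathcal A(D')),D_\alpha(\mathcal A(D')\|\mathcal A(D))\}\le\rho$ for all pairs $(D,D')=(D_i,D_{i,-j})$ (resp. $(\mathcal D,\mathcal D_{-i,j})$) with $d_{i,j}\in D_i$. In one round with current global model $x$, every client is sampled independently with probability $\lambda\in(0,1]$; the sampled clients independently run local algorithms $\mathcal A_{in}(D_k,x)$ with values in a separable real normed space; and $\mathcal A_{out}(\mathcal D)$ is the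 average of their outputs (and is $x$ if no client is sampled). **Lemma (Enhanced privacy amplification by two-stage hybrid sampling).** Let $\lambda\in(0,1]$, and let each record $d_{k,l}$ have a sampling probability $q_{k,l}\in(0,1]$. 1. Let $\alpha>1$ be real. For arbitrary local randomized algorithms, if $\mathcal A_{in}(D_i,x)$ is $(\alpha,\rho)$-RDP with respect to $d_{i,j}$, then $\mathcal A_{out}(\mathcal D)$ is $(\alpha,\rho^{\lambda})$-RDP with respect to $d_{i,j}$, where $$\rho^{\lambda}=\frac1{\alpha-1}\ln\left\{1-\lambda+\lambda e^{(\alpha-1)\rho}\right\}.$$ 2. Let $\sigma>0$, let $\tau\ge0$ be an integer, and let the local multi-step update of each client be the $\tau$-fold adaptive composition of Poisson-sampled Gaussian mechanisms in $\mathbb R^n$: in step $r$ a fresh subset $S\subseteq D_k$ is drawn, which contains each $d_{k,l}\in D_k$ independently with probability $q_{k,l}$, and $f_{k,r}(x,\text{previous outputs},S)+\mathcal N(0,\sigma^2 I)$ is released, where $f_{k,r}$ is measurable in the previous outputs and changes in Euclidean norm by at most $1$ when one record is added to $S$. Then for every integer $\alpha\ge2$ the tuple of the $\tau$ outputs of client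 $i$ is $(\alpha,\rho^\tau_{i,j})$-RDP with respect to $d_{i,j}$, where, with $\rho_G(\ell)=\ell/(2\sigma^2)$, $$\rho^\tau_{i,j}=\frac{\tau}{\alpha-1}\ln\left\{(1-q_{i,j})^{\alpha-1}(\alpha q_{i,j}-q_{i,j}+1)+\sum_{\ell=2}^{\alpha}\binom{\alpha}{\ell}(1-q_{i,j})^{\alpha-\ell}q_{i,j}^{\ell}e^{(\ell-1)\rho_G(\ell)}\right\}.$$ Consequently, if the output $\mathcal A_{in}(D_k,x)$ of each client is a measurable function, not depending on the data, of its tuple of $\tau$ outputs (for instance the tuple itself or the final local model), then $\mathcal A_{out}(\mathcal D)$ is $(\alpha,\rho^{\tau,\lambda}_{i,j})$-RDP with respect to $d_{i,j}$, where $$\rho^{\tau,\lambda}_{i,j}=\frac1{\alpha-1}\ln\left\{1-\lambda+\lambda e^{(\alpha-1)\rho^\tau_{i,j}}\right\}.$$ -/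

import Mathlib

open MeasureTheory ProbabilityTheory

noncomputable section

/-! ### Rényi divergence and Rényi differential privacy -/

/-- Rényi divergence of order `α > 1` of `P` from `Q`, an extended real number:
`(α - 1)⁻¹ * log E_{o ∼ Q} [(dP/dQ (o)) ^ α]` if `P ≪ Q`, and `+∞` otherwise. -/
def renyiDiv {Ω : Type*} [MeasurableSpace Ω] (α : ℝ) (P Q : Measure Ω) : EReal :=
  open Classical in
  if P ≪ Q then
    (((α - 1)⁻¹ : ℝ) : EReal) * ENNReal.log (∫⁻ o, (P.rnDeriv Q o) ^ α ∂Q)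
  else ⊤

/-- `(α, ρ)`-RDP of a randomized algorithm `A` (a map sending a dataset to its output law), relative
to an adjacency relation on datasets: both Rényi divergences are at most `ρ` on all adjacent
pairs. -/
def IsRDP {𝔻 Ω : Type*} [MeasurableSpace Ω] (adj : 𝔻 → 𝔻 → Prop) (α ρ : ℝ)
    (A : 𝔻 → Measure Ω) : Prop :=
  ∀ D D' : 𝔻, adj D D' →
    max (renyiDiv α (A D) (A D')) (renyiDiv α (A D') (A D)) ≤ (ρ : EReal)

/-- Record-specific adjacency of local datasets: `D` contains `d`, and `D' = D \ {d}`. -/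
def LocalAdj {X : Type*} [DecidableEq X] (d : X) (D D' : Finset X) : Prop :=
  d ∈ D ∧ D' = D.erase d

/-- Record-specific adjacency of federated datasets (one local dataset for each client): the local
dataset of client `i` contains `d`, and `𝒟'` arises from `𝒟` by deleting `d` at client `i`. -/
def FedAdj {ι X : Type*} [DecidableEq ι] [DecidableEq X] (i : ι) (d : X)
    (𝒟 𝒟' : ι → Finset X) : Prop :=
  d ∈ 𝒟 i ∧ 𝒟' = Function.update 𝒟 i ((𝒟 i).erase d)

/-! ### Poisson sampling and the local multi-step update -/

/-- The probability that Poisson sampling from `D`, in which each `x ∈ D` is included independently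
with probability `q x`, returns the subset `S` of `D`. -/
def poissonWeight {X : Type*} [DecidableEq X] (q : X → ℝ) (D S : Finset X) : ℝ :=
  ∏ x ∈ D, if x ∈ S then q x else 1 - q x

/-- The Gaussian mechanism: the law of `v + ζ`, where `ζ ∼ 𝒩(0, σ² I)`. -/
def gaussianMech {n : ℕ} (σ : ℝ) (v : EuclideanSpace ℝ (Fin n)) :
    Measure (EuclideanSpace ℝ (Fin n)) :=
  (stdGaussian (EuclideanSpace ℝ (Fin n))).map (fun z => v + σ • z)

/-- The Poisson-sampled Gaussian mechanism: the law of `f S + ζ`, where `S ⊆ D` is drawn by Poisson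
sampling with probabilities `q` and `ζ ∼ 𝒩(0, σ² I)` is independent of `S`. -/
def poiSG {X : Type*} [DecidableEq X] {n : ℕ} (σ : ℝ) (q : X → ℝ)
    (f : Finset X → EuclideanSpace ℝ (Fin n)) (D : Finset X) :
    Measure (EuclideanSpace ℝ (Fin n)) :=
  ∑ S ∈ D.powerset, ENNReal.ofReal (poissonWeight q D S) • gaussianMech σ (f S)

/-- The `τ`-fold adaptive composition of Poisson-sampled Gaussian mechanisms, that is, the joint law
of the outputs of all `τ` steps. In step `r` the query `f r h` depends on the vector `h` of the
outputs of the preceding steps, and a fresh subset of the dataset is sampled. -/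
def poiSGComp {X : Type*} [DecidableEq X] {n : ℕ} (σ : ℝ) (q : X → ℝ)
    (f : (r : ℕ) → (Fin r → EuclideanSpace ℝ (Fin n)) → Finset X → EuclideanSpace ℝ (Fin n))
    (D : Finset X) : (τ : ℕ) → Measure (Fin τ → EuclideanSpace ℝ (Fin n))
  | 0 => Measure.dirac Fin.elim0
  | r + 1 => (poiSGComp σ q f D r).bind fun h =>
      (poiSG σ q (f r h) D).map fun y =>
        (Fin.snoc h y : Fin (r + 1) → EuclideanSpace ℝ (Fin n))

/-! ### Client sampling and averaging -/

/-- The average of the vectors `y i`, `i ∈ ω`; if `ω` is empty (no client was sampled), the global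
model `x` stays as it is. -/
def clientAvg {ι V : Type*} [AddCommGroup V] [Module ℝ V] (x : V) (ω : Finset ι)
    (y : ω → V) : V :=
  open Classical in if ω.Nonempty then (ω.card : ℝ)⁻¹ • ∑ i, y i else x

/-- One round of global aggregation from the global model `x`: each client is included in the
sample `ω` independently with probability `lam`, the sampled clients run their local
algorithms `A i (𝒟 i) x` independently, and the outputs are averaged. -/
def globalRound {ι X V : Type*} [Fintype ι] [DecidableEq ι] [AddCommGroup V] [Module ℝ V]
    [MeasurableSpace V] (lam : ℝ) (A : ι → Finset X → V → Measure V) (x : V)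
    (𝒟 : ι → Finset X) : Measure V :=
  ∑ ω : Finset ι, ENNReal.ofReal (poissonWeight (fun _ => lam) Finset.univ ω) •
    (Measure.pi fun i : ω => A i (𝒟 i) x).map (clientAvg x ω)

/-! ### The privacy bounds -/

/-- The RDP curve `α ↦ α / (2 σ²)` of the Gaussian mechanism with sensitivity one. -/
def rhoG (σ α : ℝ) : ℝ := α / (2 * σ ^ 2)

/-- The bound for the Poisson-sampled Gaussian mechanism at integer order `α` and rate `q`. -/
def rhoPoiSG (σ : ℝ) (α : ℕ) (q : ℝ) : ℝ :=
  1 / ((α : ℝ) - 1) * Real.log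
    ((1 - q) ^ (α - 1) * (α * q - q + 1) +
      ∑ l ∈ Finset.Icc 2 α,
        (α.choose l : ℝ) * (1 - q) ^ (α - l) * q ^ l * Real.exp (((l : ℝ) - 1) * rhoG σ l))

/-- The amplified bound `1 / (α - 1) * ln (1 - λ + λ * exp ((α - 1) * ρ))`. -/
def rhoAmp (lam α ρ : ℝ) : ℝ :=
  1 / (α - 1) * Real.log (1 - lam + lam * Real.exp ((α - 1) * ρ))

end

/-!
By Hölder duality, `D_α(P‖Q) ≤ ρ` says that `∫ φ ∂P ≤ exp ((α - 1) ρ) ^ (1 / α) * ‖φ‖_{L^β(Q)}` for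
all measurable `φ ≥ 0`, where `β` is the exponent conjugate to `α`. In this form the moment bound
passes to mixtures with common weights, to adaptive compositions and to images. Sampling a client
or a record is such a mixture, once the samples with and without the target are coupled. An
unsampled target client contributes the moment `1` and a sampled one the moment
`exp ((α - 1) ρ)`, so one round has the moment `1 - λ + λ * exp ((α - 1) ρ)`.

For one Gaussian step the coupling leaves the comparison of the mixture
`(1 - q) 𝒩(0, I) + q 𝒩(a, I)` with `𝒩(0, I)`, where `‖a‖ ≤ 1 / σ`. The density of the mixture is
`m = 1 - q + q r`, with `r` the ratio of the two Gaussian densities, and the binomial theorem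
expresses `E[m ^ α]` through the moments of `r`. The other direction asks for
`E[m ^ (-(α - 1))] ≤ E[m ^ α]`. The reflection `z ↦ a - z` exchanges the two Gaussians and inverts
`r`, so both expectations may be symmetrized, after which the inequality holds pointwise.
-/

open scoped ENNReal RealInnerProductSpace

/-! ### Moment bounds in Hölder dual form -/

/-- The bound `∫ (dP/dQ) ^ α ∂Q ≤ C` on the Rényi moment of `P` relative to `Q`, in Hölder dual
form. Since it mentions no density, it passes to mixtures, kernels and images without any
measurable selection of Radon–Nikodym derivatives. -/
def MomentBound {Ω : Type*} [MeasurableSpace Ω] (α : ℝ) (C : ℝ≥0∞) (P Q : Measure Ω) : Prop :=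
  ∀ φ : Ω → ℝ≥0∞, Measurable φ →
    ∫⁻ o, φ o ∂P ≤ C ^ (1 / α) * (∫⁻ o, φ o ^ α.conjExponent ∂Q) ^ (1 / α.conjExponent)

namespace MomentBound

variable {Ω Ω' : Type*} [MeasurableSpace Ω] [MeasurableSpace Ω'] {α : ℝ} {C C' : ℝ≥0∞}
  {P Q : Measure Ω}

theorem of_withDensity (hα : 1 < α) {r : Ω → ℝ≥0∞} (hr : Measurable r)
    (hC : ∫⁻ o, r o ^ α ∂Q ≤ C) : MomentBound α C (Q.withDensity r) Q := by
  intro φ hφ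
  calc ∫⁻ o, φ o ∂Q.withDensity r
      = ∫⁻ o, (r * φ) o ∂Q := lintegral_withDensity_eq_lintegral_mul _ hr hφ
    _ ≤ (∫⁻ o, r o ^ α ∂Q) ^ (1 / α) *
          (∫⁻ o, φ o ^ α.conjExponent ∂Q) ^ (1 / α.conjExponent) :=
        ENNReal.lintegral_mul_le_Lp_mul_Lq Q (.conjExponent hα) hr.aemeasurable hφ.aemeasurable
    _ ≤ _ := by gcongr

theorem refl (hα : 1 < α) (Q : Measure Ω) [IsProbabilityMeasure Q] : MomentBound α 1 Q Q := by
  simpa using of_withDensity (Q := Q) (C := 1) (r := 1) hα measurable_one (by simp)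

theorem map (h : MomentBound α C P Q) {g : Ω → Ω'} (hg : Measurable g) :
    MomentBound α C (P.map g) (Q.map g) := by
  intro φ hφ
  rw [lintegral_map hφ hg, lintegral_map (hφ.pow_const _) hg]
  exact h _ (hφ.comp hg)

theorem sum (hα : 1 < α) {κ : Type*} (s : Finset κ) (w c : κ → ℝ≥0∞) {P Q : κ → Measure Ω}
    (h : ∀ k ∈ s, MomentBound α (c k) (P k) (Q k)) :
    MomentBound α (∑ k ∈ s, w k * c k) (∑ k ∈ s, w k • P k) (∑ k ∈ s, w k • Q k) := by
  intro φ hφ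
  have hαβ := Real.HolderConjugate.conjExponent hα
  set β := α.conjExponent
  have split_weight (w : ℝ≥0∞) : w = w ^ (1 / α) * w ^ (1 / β) := by
    rw [← ENNReal.rpow_add_of_nonneg _ _ hαβ.one_div_nonneg hαβ.symm.one_div_nonneg,
      one_div, one_div, hαβ.inv_add_inv_eq_one, ENNReal.rpow_one]
  have term_le (k : κ) (hk : k ∈ s) : w k * ∫⁻ o, φ o ∂P k ≤
      (w k * c k) ^ (1 / α) * (w k * ∫⁻ o, φ o ^ β ∂Q k) ^ (1 / β) := by
    rw [ENNReal.mul_rpow_of_nonneg _ _ hαβ.one_div_nonneg,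
      ENNReal.mul_rpow_of_nonneg _ _ hαβ.symm.one_div_nonneg, mul_mul_mul_comm, ← split_weight]
    gcongr
    exact h k hk φ hφ
  simp only [lintegral_finsetSum_measure, lintegral_smul_measure, smul_eq_mul]
  refine (Finset.sum_le_sum term_le).trans ((ENNReal.inner_le_Lp_mul_Lq s _ _ hαβ).trans_eq ?_)
  simp only [← ENNReal.rpow_mul, one_div_mul_cancel hαβ.ne_zero,
    one_div_mul_cancel hαβ.symm.ne_zero, ENNReal.rpow_one]

theorem bind (hα : 1 < α) (h : MomentBound α C P Q) {κ η : Ω → Measure Ω'} (hκ : Measurable κ)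
    (hη : Measurable η) (hκη : ∀ o, MomentBound α C' (κ o) (η o)) :
    MomentBound α (C * C') (P.bind κ) (Q.bind η) := by
  intro φ hφ
  have hαβ := Real.HolderConjugate.conjExponent hα
  set β := α.conjExponent
  rw [Measure.lintegral_bind hκ.aemeasurable hφ.aemeasurable,
    Measure.lintegral_bind hη.aemeasurable (hφ.pow_const _).aemeasurable]
  have hm : Measurable fun o => ∫⁻ y, φ y ^ β ∂η o :=
    (Measure.measurable_lintegral (hφ.pow_const _)).comp hη
  calc ∫⁻ o, ∫⁻ y, φ y ∂κ o ∂P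
      ≤ ∫⁻ o, C' ^ (1 / α) * (∫⁻ y, φ y ^ β ∂η o) ^ (1 / β) ∂P :=
        lintegral_mono fun o => hκη o φ hφ
    _ = C' ^ (1 / α) * ∫⁻ o, (∫⁻ y, φ y ^ β ∂η o) ^ (1 / β) ∂P :=
        lintegral_const_mul _ (hm.pow_const _)
    _ ≤ C' ^ (1 / α) * (C ^ (1 / α) *
          (∫⁻ o, ((∫⁻ y, φ y ^ β ∂η o) ^ (1 / β)) ^ β ∂Q) ^ (1 / β)) := by
        gcongr
        exact h _ (hm.pow_const _)
    _ = (C * C') ^ (1 / α) * (∫⁻ o, ∫⁻ y, φ y ^ β ∂η o ∂Q) ^ (1 / β) := by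
        simp only [← ENNReal.rpow_mul, one_div_mul_cancel hαβ.symm.ne_zero, ENNReal.rpow_one]
        rw [ENNReal.mul_rpow_of_nonneg _ _ hαβ.one_div_nonneg, ← mul_assoc, mul_comm (C ^ _)]

theorem prod (hα : 1 < α) (h : MomentBound α C P Q) {P' Q' : Measure Ω'} [SFinite P'] [SFinite Q']
    (h' : MomentBound α C' P' Q') : MomentBound α (C * C') (P.prod P') (Q.prod Q') := by
  rw [Measure.prod, Measure.prod]
  exact h.bind hα .map_prodMk_left .map_prodMk_left fun o => h'.map measurable_prodMk_left

theorem pi (hα : 1 < α) {κ : Type*} [Fintype κ] {E : κ → Type*}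
    [∀ k, MeasurableSpace (E k)] {μ ν : ∀ k, Measure (E k)} [∀ k, SigmaFinite (μ k)]
    [∀ k, IsProbabilityMeasure (ν k)] {k : κ} (hk : MomentBound α C (μ k) (ν k))
    (hne : ∀ j, j ≠ k → μ j = ν j) :
    MomentBound α C (Measure.pi μ) (Measure.pi ν) := by
  classical
  let e := MeasurableEquiv.piEquivPiSubtypeProd E (· = k)
  have hrest : (fun j : {j // j ≠ k} => μ j) = fun j : {j // j ≠ k} => ν j :=
    funext fun j => hne j j.2
  let _ : Fintype {j // j = k} := Subtype.fintype _
  have hfactor : MomentBound α C (Measure.pi fun j : {j // j = k} => μ j)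
      (Measure.pi fun j : {j // j = k} => ν j) := by
    rw [← ((measurePreserving_piUnique fun j : {j // j = k} => μ j).symm _).map_eq,
      ← ((measurePreserving_piUnique fun j : {j // j = k} => ν j).symm _).map_eq]
    exact hk.map (MeasurableEquiv.piUnique _).symm.measurable
  rw [← ((measurePreserving_piEquivPiSubtypeProd μ (· = k)).symm e).map_eq,
    ← ((measurePreserving_piEquivPiSubtypeProd ν (· = k)).symm e).map_eq, hrest, ← mul_one C]
  exact (hfactor.prod hα (refl hα (.pi fun j : {j // j ≠ k} => ν j))).map e.symm.measurable

theorem absolutelyContinuous (hα : 1 < α) (h : MomentBound α C P Q) : P ≪ Q := by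
  refine Measure.AbsolutelyContinuous.mk fun s hs hQ => ?_
  have hβ : 0 < α.conjExponent := (Real.HolderConjugate.conjExponent hα).symm.pos
  have hpow (o : Ω) : s.indicator (1 : Ω → ℝ≥0∞) o ^ α.conjExponent = s.indicator 1 o := by
    by_cases ho : o ∈ s <;> simp [ho, hβ]
  simpa [hpow, lintegral_indicator_one hs, hQ, hβ] using
    h (s.indicator 1) (measurable_one.indicator hs)

-- Testing against `min (dP/dQ) n ^ (α - 1)` gives a bound with the same finite integral on both
-- sides, which can therefore be cancelled.
theorem lintegral_min_rnDeriv_rpow_le (hα : 1 < α) [IsFiniteMeasure P] [IsFiniteMeasure Q]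
    (h : MomentBound α C P Q) (n : ℕ) : ∫⁻ o, min (P.rnDeriv Q o) n ^ α ∂Q ≤ C := by
  have hαβ := Real.HolderConjugate.conjExponent hα
  set β := α.conjExponent
  set I := ∫⁻ o, min (P.rnDeriv Q o) n ^ α ∂Q
  have hmin : Measurable fun o => min (P.rnDeriv Q o) (n : ℝ≥0∞) := by fun_prop
  have I_ne_top : I ≠ ∞ := by
    refine ne_top_of_le_ne_top (b := ∫⁻ _, (n : ℝ≥0∞) ^ α ∂Q) ?_ (lintegral_mono fun o => ?_)
    · simpa using ENNReal.mul_ne_top (by simp [hαβ.nonneg]) (measure_ne_top Q _)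
    · exact ENNReal.rpow_le_rpow (min_le_right _ _) hαβ.nonneg
  have I_le : I ≤ C ^ (1 / α) * I ^ (1 / β) := calc
    I = ∫⁻ o, min (P.rnDeriv Q o) n * min (P.rnDeriv Q o) n ^ (α - 1) ∂Q := by
        refine lintegral_congr fun o => ?_
        nth_rw 2 [← ENNReal.rpow_one (min _ _)]
        rw [← ENNReal.rpow_add_of_nonneg _ _ zero_le_one hαβ.sub_one_pos.le, add_sub_cancel]
    _ ≤ ∫⁻ o, P.rnDeriv Q o * min (P.rnDeriv Q o) n ^ (α - 1) ∂Q :=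
        lintegral_mono fun o => mul_le_mul_left (min_le_left _ _) _
    _ = ∫⁻ o, min (P.rnDeriv Q o) n ^ (α - 1) ∂P :=
        lintegral_rnDeriv_mul (h.absolutelyContinuous hα) (hmin.pow_const _).aemeasurable
    _ ≤ C ^ (1 / α) * (∫⁻ o, (min (P.rnDeriv Q o) n ^ (α - 1)) ^ β ∂Q) ^ (1 / β) :=
        h _ (hmin.pow_const _)
    _ = C ^ (1 / α) * I ^ (1 / β) := by
        simp only [← ENNReal.rpow_mul, hαβ.sub_one_mul_conj, I]
  rcases eq_or_ne I 0 with I_zero | I_ne_zero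
  · simp [I_zero]
  have hcancel : I ^ (1 / α) * I ^ (1 / β) ≤ C ^ (1 / α) * I ^ (1 / β) := by
    rwa [← ENNReal.rpow_add _ _ I_ne_zero I_ne_top, one_div, one_div, hαβ.inv_add_inv_eq_one,
      ENNReal.rpow_one, ← one_div, ← one_div]
  rw [ENNReal.mul_le_mul_iff_left (by simp [I_ne_zero, I_ne_top]) (by simp [I_ne_zero, I_ne_top]),
    ENNReal.rpow_le_rpow_iff hαβ.one_div_pos] at hcancel
  exact hcancel

theorem lintegral_rnDeriv_rpow_le (hα : 1 < α) [IsFiniteMeasure P] [IsFiniteMeasure Q]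
    (h : MomentBound α C P Q) : ∫⁻ o, P.rnDeriv Q o ^ α ∂Q ≤ C := by
  have hα0 : 0 < α := by linarith
  have eq_iSup (o : Ω) : P.rnDeriv Q o ^ α = ⨆ n : ℕ, min (P.rnDeriv Q o) n ^ α := by
    calc P.rnDeriv Q o ^ α = (⨆ n : ℕ, min (P.rnDeriv Q o) n) ^ α := by
          rw [← inf_iSup_eq, ENNReal.iSup_natCast, inf_top_eq]
      _ = ⨆ n : ℕ, min (P.rnDeriv Q o) n ^ α := (ENNReal.orderIsoRpow α hα0).map_iSup _
  simp only [eq_iSup]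
  rw [lintegral_iSup (fun n => by fun_prop)
    fun m n hmn o => ENNReal.rpow_le_rpow (by gcongr) hα0.le]
  exact iSup_le (h.lintegral_min_rnDeriv_rpow_le hα)

end MomentBound

theorem coe_inv_mul_log_le_iff {c : ℝ} (hc : 0 < c) (ρ : ℝ) (I : ℝ≥0∞) :
    ((c⁻¹ : ℝ) : EReal) * ENNReal.log I ≤ ρ ↔ I ≤ ENNReal.ofReal (Real.exp (c * ρ)) := by
  rw [EReal.coe_inv, ← EReal.div_eq_inv_mul,
    EReal.div_le_iff_le_mul (EReal.coe_pos.2 hc) (EReal.coe_ne_top _),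
    ← EReal.exp_coe, ← ENNReal.log_le_log_iff, EReal.log_exp, EReal.coe_mul]

theorem renyiDiv_le_iff {Ω : Type*} [MeasurableSpace Ω] {α ρ : ℝ} (hα : 1 < α) (P Q : Measure Ω)
    [IsFiniteMeasure P] [IsFiniteMeasure Q] :
    renyiDiv α P Q ≤ ρ ↔ MomentBound α (ENNReal.ofReal (Real.exp ((α - 1) * ρ))) P Q := by
  constructor
  · intro h
    unfold renyiDiv at h
    split_ifs at h with hPQ
    · rw [← Measure.withDensity_rnDeriv_eq P Q hPQ]
      exact .of_withDensity hα (Measure.measurable_rnDeriv P Q)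
        ((coe_inv_mul_log_le_iff (sub_pos.2 hα) _ _).1 h)
    · simp at h
  · intro h
    rw [renyiDiv, if_pos (h.absolutelyContinuous hα), coe_inv_mul_log_le_iff (sub_pos.2 hα)]
    exact h.lintegral_rnDeriv_rpow_le hα

section

variable {𝔻 Ω Ω' : Type*} [MeasurableSpace Ω] [MeasurableSpace Ω'] {adj : 𝔻 → 𝔻 → Prop} {α ρ : ℝ}
  {A : 𝔻 → Measure Ω}

theorem isRDP_iff_momentBound (hα : 1 < α) [∀ D, IsFiniteMeasure (A D)] :
    IsRDP adj α ρ A ↔ ∀ D D', adj D D' →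
      MomentBound α (ENNReal.ofReal (Real.exp ((α - 1) * ρ))) (A D) (A D') ∧
      MomentBound α (ENNReal.ofReal (Real.exp ((α - 1) * ρ))) (A D') (A D) := by
  simp only [IsRDP, max_le_iff, renyiDiv_le_iff hα]

theorem IsRDP.map (hα : 1 < α) [∀ D, IsFiniteMeasure (A D)] (h : IsRDP adj α ρ A) {g : Ω → Ω'}
    (hg : Measurable g) : IsRDP adj α ρ fun D => (A D).map g := by
  rw [isRDP_iff_momentBound hα] at h ⊢
  exact fun D D' hD => (h D D' hD).imp (·.map hg) (·.map hg)

end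

/-! ### Mixtures of a measure with a tilted copy -/

section

variable {q : ℝ}

theorem one_sub_add_mul_pos (hq : q ∈ Set.Icc (0 : ℝ) 1) {r : ℝ} (hr : 0 < r) :
    0 < 1 - q + q * r := by
  rcases hq.1.eq_or_lt with rfl | hq0
  · simp
  · exact add_pos_of_nonneg_of_pos (sub_nonneg.2 hq.2) (mul_pos hq0 hr)

/-- The palindromic sum `m ^ (-k) + ⋯ + m ^ k`, the factor of `m ^ (k + 1) - m ^ (-k)` that remains
after division by `m - 1`. -/
noncomputable def palindromicSum (k : ℕ) (m : ℝ) : ℝ :=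
  1 + ∑ l ∈ Finset.range k, (m ^ (l + 1) + (m ^ (l + 1))⁻¹)

theorem sub_one_mul_palindromicSum (k : ℕ) {m : ℝ} (hm : m ≠ 0) :
    (m - 1) * palindromicSum k m = m ^ (k + 1) - (m ^ k)⁻¹ := by
  induction k with
  | zero => simp [palindromicSum]
  | succ k ih =>
    rw [palindromicSum, Finset.sum_range_succ, ← add_assoc, mul_add, ← palindromicSum, ih]
    field_simp
    ring

theorem palindromicSum_inv (k : ℕ) (m : ℝ) : palindromicSum k m⁻¹ = palindromicSum k m := by
  simp only [palindromicSum, inv_pow, inv_inv, add_comm]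

theorem monotoneOn_add_inv : MonotoneOn (fun m : ℝ => m + m⁻¹) (Set.Ici 1) := by
  intro x (hx : 1 ≤ x) y (hy : 1 ≤ y) hxy
  have hdiff : y + y⁻¹ - (x + x⁻¹) = (y - x) * (1 - (x * y)⁻¹) := by
    field_simp
    ring
  have : 0 ≤ (y - x) * (1 - (x * y)⁻¹) :=
    mul_nonneg (sub_nonneg.2 hxy) <| sub_nonneg.2 <|
      inv_le_one_of_one_le₀ (one_le_mul_of_one_le_of_one_le hx hy)
  simp only
  linarith

theorem monotoneOn_palindromicSum (k : ℕ) : MonotoneOn (palindromicSum k) (Set.Ici 1) := by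
  intro x (hx : 1 ≤ x) y (hy : 1 ≤ y) hxy
  unfold palindromicSum
  gcongr 1 + ∑ l ∈ _, ?_
  exact monotoneOn_add_inv (one_le_pow₀ hx) (one_le_pow₀ hy) (by gcongr)

theorem palindromicSum_le_of_one_le_mul (k : ℕ) {x y : ℝ} (hx : 0 < x) (hx1 : x ≤ 1)
    (hxy : 1 ≤ x * y) : palindromicSum k x ≤ palindromicSum k y := by
  have hle : x⁻¹ ≤ y := (inv_le_iff_one_le_mul₀' hx).2 hxy
  have hinv : 1 ≤ x⁻¹ := (one_le_inv₀ hx).2 hx1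
  rw [← palindromicSum_inv]
  exact monotoneOn_palindromicSum k hinv (hinv.trans hle) hle

theorem one_le_mixture_mul_mixture_inv (hq : q ∈ Set.Icc (0 : ℝ) 1) {r : ℝ} (hr : 0 < r) :
    1 ≤ (1 - q + q * r) * (1 - q + q * r⁻¹) := by
  have hprod : (1 - q + q * r) * (1 - q + q * r⁻¹) = 1 + q * (1 - q) * (r - 1) ^ 2 * r⁻¹ := by
    field_simp
    ring
  have hq1 : 0 ≤ 1 - q := sub_nonneg.2 hq.2
  have hq0 := hq.1
  rw [hprod, le_add_iff_nonneg_right]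
  positivity

theorem inv_pow_add_le_pow_add (hq : q ∈ Set.Icc (0 : ℝ) 1) {r : ℝ} (hr : 0 < r) (k : ℕ) :
    ((1 - q + q * r) ^ k)⁻¹ + r * ((1 - q + q * r⁻¹) ^ k)⁻¹ ≤
      (1 - q + q * r) ^ (k + 1) + r * (1 - q + q * r⁻¹) ^ (k + 1) := by
  have hm := one_sub_add_mul_pos hq hr
  have hm' := one_sub_add_mul_pos hq (inv_pos.2 hr)
  have hmm' := one_le_mixture_mul_mixture_inv hq hr
  have hm_sub : 1 - q + q * r - 1 = q * (r - 1) := by ring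
  have hm'_sub : r * (1 - q + q * r⁻¹ - 1) = -(q * (r - 1)) := by
    field_simp
    ring
  have hfactor := sub_one_mul_palindromicSum k hm.ne'
  have hfactor' := sub_one_mul_palindromicSum k hm'.ne'
  rw [hm_sub] at hfactor
  suffices 0 ≤ q * (r - 1) *
      (palindromicSum k (1 - q + q * r) - palindromicSum k (1 - q + q * r⁻¹)) by
    linear_combination this + hfactor + r * hfactor' -
      palindromicSum k (1 - q + q * r⁻¹) * hm'_sub
  rcases le_total 1 r with h | h
  · have hm'_le : 1 - q + q * r⁻¹ ≤ 1 := by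
      linarith [mul_le_of_le_one_right hq.1 (inv_le_one_of_one_le₀ h)]
    exact mul_nonneg (mul_nonneg hq.1 (sub_nonneg.2 h)) <| sub_nonneg.2 <|
      palindromicSum_le_of_one_le_mul k hm' hm'_le (by rwa [mul_comm])
  · have hm_le : 1 - q + q * r ≤ 1 := by linarith [mul_le_of_le_one_right hq.1 h]
    exact mul_nonneg_of_nonpos_of_nonpos (mul_nonpos_of_nonneg_of_nonpos hq.1 (sub_nonpos.2 h)) <|
      sub_nonpos.2 <| palindromicSum_le_of_one_le_mul k hm hm_le hmm'

variable {Ω : Type*} [MeasurableSpace Ω] {γ : Measure Ω} {r : Ω → ℝ}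

theorem smul_add_smul_withDensity (hq : q ∈ Set.Icc (0 : ℝ) 1) (hr : Measurable r)
    (hr0 : ∀ z, 0 ≤ r z) :
    ENNReal.ofReal (1 - q) • γ + ENNReal.ofReal q • γ.withDensity (fun z => ENNReal.ofReal (r z)) =
      γ.withDensity fun z => ENNReal.ofReal (1 - q + q * r z) := by
  have hdensity : (fun z => ENNReal.ofReal (1 - q + q * r z)) =
      (fun _ => ENNReal.ofReal (1 - q)) + ENNReal.ofReal q • fun z => ENNReal.ofReal (r z) := by
    funext z
    rw [ENNReal.ofReal_add (sub_nonneg.2 hq.2) (mul_nonneg hq.1 (hr0 z)), ENNReal.ofReal_mul hq.1]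
    rfl
  rw [hdensity, withDensity_add_left measurable_const, withDensity_const,
    withDensity_smul _ hr.ennreal_ofReal]

theorem lintegral_mixture_pow (hq : q ∈ Set.Icc (0 : ℝ) 1) (hr : Measurable r)
    (hr0 : ∀ z, 0 ≤ r z) (k : ℕ) :
    ∫⁻ z, ENNReal.ofReal (1 - q + q * r z) ^ k ∂γ =
      ∑ l ∈ Finset.range (k + 1), ENNReal.ofReal (k.choose l * (1 - q) ^ (k - l) * q ^ l) *
        ∫⁻ z, ENNReal.ofReal (r z) ^ l ∂γ := by
  have hq0 := hq.1
  have hq1 : 0 ≤ 1 - q := sub_nonneg.2 hq.2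
  have binomial (z : Ω) : ENNReal.ofReal (1 - q + q * r z) ^ k = ∑ l ∈ Finset.range (k + 1),
      ENNReal.ofReal (k.choose l * (1 - q) ^ (k - l) * q ^ l) * ENNReal.ofReal (r z) ^ l := by
    have hz := hr0 z
    rw [← ENNReal.ofReal_pow (by positivity), add_comm, add_pow,
      ENNReal.ofReal_sum_of_nonneg fun l _ => by positivity]
    refine Finset.sum_congr rfl fun l _ => ?_
    rw [← ENNReal.ofReal_pow hz, ← ENNReal.ofReal_mul (by positivity)]
    ring_nf
  simp only [binomial]
  rw [lintegral_finsetSum _ fun l _ => by fun_prop]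
  exact Finset.sum_congr rfl fun l _ => lintegral_const_mul _ (by fun_prop)

section Reflection

variable (hr : Measurable r) (hr0 : ∀ z, 0 < r z)
  (hsymm : (γ.withDensity fun z => ENNReal.ofReal (r z)).map (fun z => (r z)⁻¹) = γ.map r)

include hr hr0 hsymm

theorem two_mul_lintegral_eq_of_reflection {g : ℝ → ℝ} (hg : Measurable g)
    (hg0 : ∀ t, 0 < t → 0 ≤ g t) :
    2 * ∫⁻ z, ENNReal.ofReal (g (r z)) ∂γ =
      ∫⁻ z, ENNReal.ofReal (g (r z) + r z * g (r z)⁻¹) ∂γ := by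
  have hgE : Measurable fun t => ENNReal.ofReal (g t) := hg.ennreal_ofReal
  have reflect : ∫⁻ z, ENNReal.ofReal (g (r z)) ∂γ =
      ∫⁻ z, ENNReal.ofReal (r z * g (r z)⁻¹) ∂γ := by
    rw [← lintegral_map hgE hr, ← hsymm, lintegral_map hgE (by fun_prop),
      lintegral_withDensity_eq_lintegral_mul _ (by fun_prop) (by fun_prop)]
    exact lintegral_congr fun z => (ENNReal.ofReal_mul (hr0 z).le).symm
  rw [two_mul]
  nth_rw 2 [reflect]
  rw [← lintegral_add_left (by fun_prop)]
  exact lintegral_congr fun z => (ENNReal.ofReal_add (hg0 _ (hr0 z))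
    (mul_nonneg (hr0 z).le (hg0 _ (inv_pos.2 (hr0 z))))).symm

theorem lintegral_inv_mixture_pow_le (hq : q ∈ Set.Icc (0 : ℝ) 1) (k : ℕ) :
    ∫⁻ z, ENNReal.ofReal ((1 - q + q * r z) ^ k)⁻¹ ∂γ ≤
      ∫⁻ z, ENNReal.ofReal ((1 - q + q * r z) ^ (k + 1)) ∂γ := by
  have hpos (t : ℝ) (ht : 0 < t) := one_sub_add_mul_pos hq ht
  rw [← ENNReal.mul_le_mul_iff_right two_ne_zero ENNReal.ofNat_ne_top,
    two_mul_lintegral_eq_of_reflection hr hr0 hsymm (g := fun t => ((1 - q + q * t) ^ k)⁻¹)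
      (by fun_prop) fun t ht => (inv_pos.2 (pow_pos (hpos t ht) k)).le,
    two_mul_lintegral_eq_of_reflection hr hr0 hsymm (g := fun t => (1 - q + q * t) ^ (k + 1))
      (by fun_prop) fun t ht => (pow_pos (hpos t ht) _).le]
  exact lintegral_mono fun z => ENNReal.ofReal_le_ofReal (inv_pow_add_le_pow_add hq (hr0 z) k)

end Reflection

namespace MomentBound

variable {C : ℝ≥0∞} {k : ℕ}

theorem of_mixture (hk : 1 < k) (hr : Measurable r)
    (hC : ∫⁻ z, ENNReal.ofReal (1 - q + q * r z) ^ k ∂γ ≤ C) :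
    MomentBound k C (γ.withDensity fun z => ENNReal.ofReal (1 - q + q * r z)) γ :=
  of_withDensity (by exact_mod_cast hk) (by fun_prop) (by simpa only [ENNReal.rpow_natCast])

theorem of_mixture_symm (hk : 1 < k) (hq : q ∈ Set.Icc (0 : ℝ) 1) (hr : Measurable r)
    (hr0 : ∀ z, 0 < r z)
    (hsymm : (γ.withDensity fun z => ENNReal.ofReal (r z)).map (fun z => (r z)⁻¹) = γ.map r)
    (hC : ∫⁻ z, ENNReal.ofReal (1 - q + q * r z) ^ k ∂γ ≤ C) :
    MomentBound k C γ (γ.withDensity fun z => ENNReal.ofReal (1 - q + q * r z)) := by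
  set m : Ω → ℝ≥0∞ := fun z => ENNReal.ofReal (1 - q + q * r z)
  have hm : Measurable m := by fun_prop
  have hpos (z : Ω) := one_sub_add_mul_pos hq (hr0 z)
  have hm_ne_zero (z : Ω) : m z ≠ 0 := by simpa [m] using hpos z
  have hm_ne_top (z : Ω) : m z ≠ ∞ := ENNReal.ofReal_ne_top
  have inv_moment_le : ∫⁻ z, (m z)⁻¹ ^ k ∂γ.withDensity m ≤ C := by
    obtain ⟨j, rfl⟩ := Nat.exists_eq_add_of_le' hk.le
    calc ∫⁻ z, (m z)⁻¹ ^ (j + 1) ∂γ.withDensity m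
        = ∫⁻ z, ENNReal.ofReal ((1 - q + q * r z) ^ j)⁻¹ ∂γ := by
          rw [lintegral_withDensity_eq_lintegral_mul _ hm (by fun_prop)]
          refine lintegral_congr fun z => ?_
          rw [Pi.mul_apply, pow_succ', ← mul_assoc, ENNReal.mul_inv_cancel (hm_ne_zero z)
            (hm_ne_top z), one_mul, ENNReal.ofReal_inv_of_pos (pow_pos (hpos z) j),
            ENNReal.ofReal_pow (hpos z).le, ENNReal.inv_pow]
      _ ≤ ∫⁻ z, ENNReal.ofReal ((1 - q + q * r z) ^ (j + 1)) ∂γ :=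
          lintegral_inv_mixture_pow_le hr hr0 hsymm hq j
      _ ≤ C := by simpa only [fun z => ENNReal.ofReal_pow (hpos z).le (j + 1)]
  have h := of_withDensity (α := k) (by exact_mod_cast hk) hm.inv
    (by simpa only [ENNReal.rpow_natCast])
  rwa [Pi.inv_def, withDensity_inv_same hm (.of_forall hm_ne_zero)
    (.of_forall hm_ne_top)] at h

end MomentBound

end

/-! ### Translates of the standard Gaussian measure -/

section

variable {E : Type*} [NormedAddCommGroup E] [InnerProductSpace ℝ E]

/-- The density of the translate by `a` of the standard Gaussian measure, with respect to the
standard Gaussian measure (Cameron–Martin). -/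
noncomputable def gaussianRatio (a z : E) : ℝ := Real.exp (⟪a, z⟫ - ‖a‖ ^ 2 / 2)

theorem gaussianRatio_pos (a z : E) : 0 < gaussianRatio a z := Real.exp_pos _

theorem gaussianRatio_sub (a z : E) : gaussianRatio a (a - z) = (gaussianRatio a z)⁻¹ := by
  rw [gaussianRatio, gaussianRatio, ← Real.exp_neg, inner_sub_right, real_inner_self_eq_norm_sq]
  ring_nf

theorem gaussianRatio_pow (a z : E) (l : ℕ) :
    gaussianRatio a z ^ l =
      Real.exp (l * (l - 1) / 2 * ‖a‖ ^ 2) * gaussianRatio ((l : ℝ) • a) z := by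
  rw [gaussianRatio, gaussianRatio, ← Real.exp_nat_mul, ← Real.exp_add, real_inner_smul_left,
    norm_smul, Real.norm_natCast]
  ring_nf

theorem exp_inner_mul_gaussianRatio (a b z : E) :
    Real.exp ⟪b, z⟫ * gaussianRatio a z = Real.exp (-(‖a‖ ^ 2 / 2)) * Real.exp ⟪b + a, z⟫ := by
  rw [gaussianRatio, ← Real.exp_add, ← Real.exp_add, inner_add_left]
  ring_nf

variable [FiniteDimensional ℝ E] [MeasurableSpace E] [BorelSpace E]

theorem measurable_gaussianRatio (a : E) : Measurable (gaussianRatio a) := by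
  unfold gaussianRatio
  fun_prop

theorem map_inner_stdGaussian (a : E) :
    (stdGaussian E).map (fun z => ⟪a, z⟫) = gaussianReal 0 (‖a‖₊ ^ 2) := by
  have h := IsGaussian.map_eq_gaussianReal (μ := stdGaussian E) (innerSL ℝ a)
  rw [integral_strongDual_stdGaussian, variance_dual_stdGaussian, innerSL_apply_norm] at h
  rw [← coe_nnnorm, ← NNReal.coe_pow, Real.toNNReal_coe] at h
  exact h

theorem integrable_exp_inner_stdGaussian (a : E) :
    Integrable (fun z => Real.exp ⟪a, z⟫) (stdGaussian E) := by
  have h := integrable_exp_mul_gaussianReal (μ := 0) (v := ‖a‖₊ ^ 2) 1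
  rw [← map_inner_stdGaussian, integrable_map_measure (by fun_prop) (by fun_prop)] at h
  simpa [Function.comp_def] using h

theorem integral_exp_inner_stdGaussian (a : E) :
    ∫ z, Real.exp ⟪a, z⟫ ∂stdGaussian E = Real.exp (‖a‖ ^ 2 / 2) := by
  simpa [mgf] using mgf_gaussianReal (map_inner_stdGaussian a) 1

theorem integral_exp_inner_mul_gaussianRatio (a b : E) :
    ∫ z, Real.exp ⟪b, z⟫ * gaussianRatio a z ∂stdGaussian E =
      ∫ z, Real.exp ⟪b, z + a⟫ ∂stdGaussian E := by
  simp only [exp_inner_mul_gaussianRatio, inner_add_right b, Real.exp_add ⟪b, _⟫]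
  rw [integral_const_mul, integral_mul_const, integral_exp_inner_stdGaussian,
    integral_exp_inner_stdGaussian, ← Real.exp_add, ← Real.exp_add, norm_add_sq_real]
  ring_nf

theorem mgf_inner_stdGaussian_map_add (a t : E) :
    mgf (fun z => ⟪t, z⟫) ((stdGaussian E).map fun z => z + a) =
      mgf (fun z => ⟪t, z⟫)
        ((stdGaussian E).withDensity fun z => ENNReal.ofReal (gaussianRatio a z)) := by
  have hr := measurable_gaussianRatio a
  funext s
  rw [mgf, mgf, integral_withDensity_eq_integral_toReal_smul (by fun_prop) (by simp),
    integral_map (by fun_prop) (by fun_prop)]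
  simpa [ENNReal.toReal_ofReal (gaussianRatio_pos a _).le, real_inner_smul_left, mul_comm]
    using (integral_exp_inner_mul_gaussianRatio a (s • t)).symm

theorem integrableExpSet_inner_stdGaussian_map_add (a t : E) :
    integrableExpSet (fun z => ⟪t, z⟫) ((stdGaussian E).map fun z => z + a) = Set.univ := by
  refine Set.eq_univ_of_forall fun s => ?_
  change Integrable _ _
  rw [integrable_map_measure (by fun_prop) (by fun_prop)]
  simpa [Function.comp_def, inner_add_right, mul_add, Real.exp_add, real_inner_smul_left]
    using (integrable_exp_inner_stdGaussian (s • t)).mul_const (Real.exp (s * ⟪t, a⟫))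

theorem lintegral_gaussianRatio (a : E) :
    ∫⁻ z, ENNReal.ofReal (gaussianRatio a z) ∂stdGaussian E = 1 := by
  have h : ∫ z, gaussianRatio a z ∂stdGaussian E = 1 := by
    simpa using integral_exp_inner_mul_gaussianRatio a 0
  have h_integrable : Integrable (gaussianRatio a) (stdGaussian E) :=
    .of_integral_ne_zero (by simp [h])
  rw [← ofReal_integral_eq_lintegral_ofReal h_integrable
    (.of_forall fun z => (gaussianRatio_pos a z).le), h, ENNReal.ofReal_one]

theorem stdGaussian_map_add (a : E) :
    (stdGaussian E).map (fun z => z + a) =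
      (stdGaussian E).withDensity fun z => ENNReal.ofReal (gaussianRatio a z) := by
  have : IsProbabilityMeasure ((stdGaussian E).map fun z => z + a) :=
    Measure.isProbabilityMeasure_map (by fun_prop)
  have := isFiniteMeasure_withDensity (μ := stdGaussian E)
    (f := fun z => ENNReal.ofReal (gaussianRatio a z)) (by simp [lintegral_gaussianRatio])
  refine Measure.ext_of_charFun (funext fun t => ?_)
  have h := eqOn_complexMGF_of_mgf (mgf_inner_stdGaussian_map_add a t)
    (x := Complex.I) (by simp [integrableExpSet_inner_stdGaussian_map_add])
  simpa [complexMGF, charFun_apply, real_inner_comm, mul_comm] using h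

theorem lintegral_gaussianRatio_pow (a : E) (l : ℕ) :
    ∫⁻ z, ENNReal.ofReal (gaussianRatio a z) ^ l ∂stdGaussian E =
      ENNReal.ofReal (Real.exp (l * (l - 1) / 2 * ‖a‖ ^ 2)) := by
  have hr := measurable_gaussianRatio ((l : ℝ) • a)
  have hpow (z : E) : ENNReal.ofReal (gaussianRatio a z) ^ l =
      ENNReal.ofReal (Real.exp (l * (l - 1) / 2 * ‖a‖ ^ 2)) *
        ENNReal.ofReal (gaussianRatio ((l : ℝ) • a) z) := by
    rw [← ENNReal.ofReal_pow (gaussianRatio_pos a z).le, gaussianRatio_pow,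
      ENNReal.ofReal_mul (Real.exp_pos _).le]
  simp only [hpow]
  rw [lintegral_const_mul _ (by fun_prop), lintegral_gaussianRatio, mul_one]

theorem stdGaussian_map_const_sub (a : E) :
    (stdGaussian E).map (fun z => a - z) = (stdGaussian E).map fun z => z + a := by
  conv_rhs => rw [← stdGaussian_map (LinearIsometryEquiv.neg ℝ (E := E))]
  rw [Measure.map_map (by fun_prop) (by fun_prop)]
  simp [Function.comp_def, sub_eq_neg_add]

-- The reflection `z ↦ a - z` exchanges the standard Gaussian measure with its translate by `a`.
theorem map_inv_gaussianRatio (a : E) :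
    ((stdGaussian E).withDensity fun z => ENNReal.ofReal (gaussianRatio a z)).map
      (fun z => (gaussianRatio a z)⁻¹) = (stdGaussian E).map (gaussianRatio a) := by
  have hr := measurable_gaussianRatio a
  rw [← stdGaussian_map_add, ← stdGaussian_map_const_sub, Measure.map_map (by fun_prop)
    (by fun_prop)]
  simp [Function.comp_def, gaussianRatio_sub]

end

/-! ### The moment of the Poisson-sampled Gaussian mechanism -/

section

variable {σ : ℝ} {α : ℕ} {q : ℝ}

/-- The Rényi moment `exp ((α - 1) * rhoPoiSG σ α q)` of the Poisson-sampled Gaussian mechanism,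
written as a binomial expectation; the terms `l = 0, 1` carry no exponential factor, and their sum
is the first summand in `rhoPoiSG`. -/
noncomputable def poiSGMoment (σ : ℝ) (α : ℕ) (q : ℝ) : ℝ :=
  ∑ l ∈ Finset.range (α + 1),
    (α.choose l : ℝ) * (1 - q) ^ (α - l) * q ^ l * Real.exp (((l : ℝ) - 1) * rhoG σ l)

theorem poiSGMoment_eq (hα : 2 ≤ α) (σ q : ℝ) :
    poiSGMoment σ α q = (1 - q) ^ (α - 1) * (α * q - q + 1) +
      ∑ l ∈ Finset.Icc 2 α,
        (α.choose l : ℝ) * (1 - q) ^ (α - l) * q ^ l * Real.exp (((l : ℝ) - 1) * rhoG σ l) := by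
  obtain ⟨k, rfl⟩ := Nat.exists_eq_add_of_le' hα
  rw [poiSGMoment, ← Finset.sum_range_add_sum_Ico _ (show 2 ≤ k + 2 + 1 by lia),
    Finset.Ico_add_one_right_eq_Icc]
  congr 1
  simp [Finset.sum_range_succ, rhoG]
  ring

theorem natCast_mul_sub_one_nonneg (l : ℕ) : 0 ≤ (l : ℝ) * (l - 1) := by
  cases l with
  | zero => simp
  | succ k =>
    rw [Nat.cast_add_one, add_sub_cancel_right]
    positivity

theorem sub_one_mul_rhoG (σ l : ℝ) : (l - 1) * rhoG σ l = l * (l - 1) / 2 * (σ ^ 2)⁻¹ := by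
  rw [rhoG, div_eq_mul_inv l, mul_inv]
  ring

theorem one_le_poiSGMoment (σ : ℝ) (α : ℕ) (hq : q ∈ Set.Icc (0 : ℝ) 1) :
    1 ≤ poiSGMoment σ α q := by
  have hq0 := hq.1
  have hq1 : 0 ≤ 1 - q := sub_nonneg.2 hq.2
  have one_le_exp (l : ℕ) : 1 ≤ Real.exp (((l : ℝ) - 1) * rhoG σ l) := by
    rw [Real.one_le_exp_iff, sub_one_mul_rhoG]
    have := natCast_mul_sub_one_nonneg l
    positivity
  calc (1 : ℝ) = (q + (1 - q)) ^ α := by simp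
    _ = ∑ l ∈ Finset.range (α + 1), (α.choose l : ℝ) * (1 - q) ^ (α - l) * q ^ l := by
        rw [add_pow]
        exact Finset.sum_congr rfl fun l _ => by ring
    _ ≤ poiSGMoment σ α q :=
        Finset.sum_le_sum fun l _ => le_mul_of_one_le_right (by positivity) (one_le_exp l)

theorem exp_mul_rhoPoiSG (hα : 2 ≤ α) (hq : q ∈ Set.Icc (0 : ℝ) 1) :
    Real.exp (((α : ℝ) - 1) * rhoPoiSG σ α q) = poiSGMoment σ α q := by
  have hα' : (α : ℝ) - 1 ≠ 0 := sub_ne_zero.2 (by exact_mod_cast (show α ≠ 1 by lia))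
  rw [rhoPoiSG, ← poiSGMoment_eq hα, ← mul_assoc, mul_one_div_cancel hα', one_mul,
    Real.exp_log (zero_lt_one.trans_le (one_le_poiSGMoment σ α hq))]

variable {E : Type*} [NormedAddCommGroup E] [InnerProductSpace ℝ E] [FiniteDimensional ℝ E]
  [MeasurableSpace E] [BorelSpace E] {a : E}

theorem lintegral_gaussianRatio_pow_le (ha : ‖a‖ ^ 2 ≤ (σ ^ 2)⁻¹) (l : ℕ) :
    ∫⁻ z, ENNReal.ofReal (gaussianRatio a z) ^ l ∂stdGaussian E ≤
      ENNReal.ofReal (Real.exp (((l : ℝ) - 1) * rhoG σ l)) := by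
  have hl := natCast_mul_sub_one_nonneg l
  rw [lintegral_gaussianRatio_pow, sub_one_mul_rhoG]
  gcongr

theorem lintegral_gaussian_mixture_pow_le (hq : q ∈ Set.Icc (0 : ℝ) 1)
    (ha : ‖a‖ ^ 2 ≤ (σ ^ 2)⁻¹) :
    ∫⁻ z, ENNReal.ofReal (1 - q + q * gaussianRatio a z) ^ α ∂stdGaussian E ≤
      ENNReal.ofReal (poiSGMoment σ α q) := by
  have hq0 := hq.1
  have hq1 : 0 ≤ 1 - q := sub_nonneg.2 hq.2
  rw [lintegral_mixture_pow hq (measurable_gaussianRatio a) fun z => (gaussianRatio_pos a z).le,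
    poiSGMoment, ENNReal.ofReal_sum_of_nonneg fun l _ => by positivity]
  refine Finset.sum_le_sum fun l _ => ?_
  rw [ENNReal.ofReal_mul' (Real.exp_pos _).le]
  exact mul_le_mul_right (lintegral_gaussianRatio_pow_le ha l) _

theorem gaussian_mixture_eq_withDensity (hq : q ∈ Set.Icc (0 : ℝ) 1) (a : E) :
    ENNReal.ofReal (1 - q) • stdGaussian E +
        ENNReal.ofReal q • (stdGaussian E).map (fun z => z + a) =
      (stdGaussian E).withDensity fun z => ENNReal.ofReal (1 - q + q * gaussianRatio a z) := by
  rw [stdGaussian_map_add]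
  exact smul_add_smul_withDensity hq (measurable_gaussianRatio a)
    fun z => (gaussianRatio_pos a z).le

theorem momentBound_gaussian_mixture (hα : 2 ≤ α) (hq : q ∈ Set.Icc (0 : ℝ) 1)
    (ha : ‖a‖ ^ 2 ≤ (σ ^ 2)⁻¹) :
    MomentBound α (ENNReal.ofReal (poiSGMoment σ α q))
      (ENNReal.ofReal (1 - q) • stdGaussian E +
        ENNReal.ofReal q • (stdGaussian E).map (fun z => z + a)) (stdGaussian E) := by
  rw [gaussian_mixture_eq_withDensity hq]
  exact .of_mixture hα (measurable_gaussianRatio a) (lintegral_gaussian_mixture_pow_le hq ha)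

theorem momentBound_gaussian_mixture_symm (hα : 2 ≤ α) (hq : q ∈ Set.Icc (0 : ℝ) 1)
    (ha : ‖a‖ ^ 2 ≤ (σ ^ 2)⁻¹) :
    MomentBound α (ENNReal.ofReal (poiSGMoment σ α q)) (stdGaussian E)
      (ENNReal.ofReal (1 - q) • stdGaussian E +
        ENNReal.ofReal q • (stdGaussian E).map (fun z => z + a)) := by
  rw [gaussian_mixture_eq_withDensity hq]
  exact .of_mixture_symm hα hq (measurable_gaussianRatio a) (gaussianRatio_pos a)
    (map_inv_gaussianRatio a) (lintegral_gaussian_mixture_pow_le hq ha)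

end

/-! ### Poisson sampling -/

section

variable {X : Type*} [DecidableEq X] {q : X → ℝ} {D : Finset X}

theorem poissonWeight_nonneg (hq : ∀ x ∈ D, q x ∈ Set.Icc (0 : ℝ) 1) (S : Finset X) :
    0 ≤ poissonWeight q D S :=
  Finset.prod_nonneg fun x hx => by
    split_ifs
    · exact (hq x hx).1
    · exact sub_nonneg.2 (hq x hx).2

theorem sum_poissonWeight_insert {M : Type*} [AddCommMonoid M] [Module ℝ≥0∞ M]
    (hq : ∀ x ∈ D, q x ∈ Set.Icc (0 : ℝ) 1) {d : X} (hd : d ∉ D) (F : Finset X → M) :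
    ∑ S ∈ (insert d D).powerset, ENNReal.ofReal (poissonWeight q (insert d D) S) • F S =
      ∑ S ∈ D.powerset, ENNReal.ofReal (poissonWeight q D S) •
        (ENNReal.ofReal (1 - q d) • F S + ENNReal.ofReal (q d) • F (insert d S)) := by
  rw [Finset.sum_powerset_insert hd, ← Finset.sum_add_distrib]
  refine Finset.sum_congr rfl fun S hS => ?_
  have hdS : d ∉ S := fun h => hd (Finset.mem_powerset.1 hS h)
  have weight_out : poissonWeight q (insert d D) S = poissonWeight q D S * (1 - q d) := by
    rw [poissonWeight, Finset.prod_insert hd, if_neg hdS, mul_comm, poissonWeight]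
  have weight_in : poissonWeight q (insert d D) (insert d S) = poissonWeight q D S * q d := by
    rw [poissonWeight, Finset.prod_insert hd, if_pos (Finset.mem_insert_self d S), mul_comm,
      poissonWeight]
    congr 1
    refine Finset.prod_congr rfl fun x hx => ?_
    simp only [Finset.mem_insert, ne_of_mem_of_not_mem hx hd, false_or]
  simp only [weight_out, weight_in, ENNReal.ofReal_mul (poissonWeight_nonneg hq S), mul_smul,
    smul_add]

theorem sum_ofReal_poissonWeight (hq : ∀ x ∈ D, q x ∈ Set.Icc (0 : ℝ) 1) :
    ∑ S ∈ D.powerset, ENNReal.ofReal (poissonWeight q D S) = 1 := by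
  induction D using Finset.induction_on with
  | empty => simp [poissonWeight]
  | insert d D hd ih =>
    have hqd := hq d (Finset.mem_insert_self d D)
    have hqD (x : X) (hx : x ∈ D) := hq x (Finset.mem_insert_of_mem hx)
    simpa [← ENNReal.ofReal_add (sub_nonneg.2 hqd.2) hqd.1, ih hqD] using
      sum_poissonWeight_insert hqD hd fun _ => (1 : ℝ≥0∞)

theorem sum_poissonWeight_mul_ite (hq : ∀ x ∈ D, q x ∈ Set.Icc (0 : ℝ) 1) {d : X} (hd : d ∈ D)
    (a b : ℝ≥0∞) :
    ∑ S ∈ D.powerset, ENNReal.ofReal (poissonWeight q D S) * (if d ∈ S then b else a) =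
      ENNReal.ofReal (1 - q d) * a + ENNReal.ofReal (q d) * b := by
  have hq' (x : X) (hx : x ∈ D.erase d) := hq x (Finset.mem_of_mem_erase hx)
  have h := sum_poissonWeight_insert hq' (D.notMem_erase d) fun S => if d ∈ S then b else a
  simp only [Finset.insert_erase hd, smul_eq_mul] at h
  have notMem (S : Finset X) (hS : S ∈ (D.erase d).powerset) : d ∉ S := fun hdS =>
    D.notMem_erase d (Finset.mem_powerset.1 hS hdS)
  calc _ = ∑ S ∈ (D.erase d).powerset, ENNReal.ofReal (poissonWeight q (D.erase d) S) *
          (ENNReal.ofReal (1 - q d) * a + ENNReal.ofReal (q d) * b) :=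
        h.trans <| Finset.sum_congr rfl fun S hS => by
          rw [if_neg (notMem S hS), if_pos (Finset.mem_insert_self d S)]
    _ = _ := by rw [← Finset.sum_mul, sum_ofReal_poissonWeight hq', one_mul]

theorem isProbabilityMeasure_poissonMixture {Ω : Type*} [MeasurableSpace Ω]
    (hq : ∀ x ∈ D, q x ∈ Set.Icc (0 : ℝ) 1) (P : Finset X → Measure Ω)
    [∀ S, IsProbabilityMeasure (P S)] :
    IsProbabilityMeasure (∑ S ∈ D.powerset, ENNReal.ofReal (poissonWeight q D S) • P S) := by
  constructor
  simpa using sum_ofReal_poissonWeight hq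

theorem MomentBound.poissonMixture {Ω : Type*} [MeasurableSpace Ω] {α : ℝ} {C : ℝ≥0∞} (hα : 1 < α)
    (hq : ∀ x ∈ D, q x ∈ Set.Icc (0 : ℝ) 1) {P Q : Finset X → Measure Ω}
    (h : ∀ S ∈ D.powerset, MomentBound α C (P S) (Q S)) :
    MomentBound α C (∑ S ∈ D.powerset, ENNReal.ofReal (poissonWeight q D S) • P S)
      (∑ S ∈ D.powerset, ENNReal.ofReal (poissonWeight q D S) • Q S) := by
  simpa [← Finset.sum_mul, sum_ofReal_poissonWeight hq] using
    MomentBound.sum hα D.powerset (fun S => ENNReal.ofReal (poissonWeight q D S)) (fun _ => C) h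

end

/-! ### The local multi-step update -/

section

variable {n : ℕ} {σ : ℝ}

instance isProbabilityMeasure_gaussianMech (σ : ℝ) (v : EuclideanSpace ℝ (Fin n)) :
    IsProbabilityMeasure (gaussianMech σ v) :=
  Measure.isProbabilityMeasure_map (by fun_prop)

theorem smul_gaussianMech_add_smul_gaussianMech (hσ : σ ≠ 0) (w₁ w₂ : ℝ≥0∞)
    (u v : EuclideanSpace ℝ (Fin n)) :
    w₁ • gaussianMech σ u + w₂ • gaussianMech σ v =
      (w₁ • stdGaussian (EuclideanSpace ℝ (Fin n)) +
        w₂ • (stdGaussian _).map (fun z => z + σ⁻¹ • (v - u))).map (fun z => u + σ • z) := by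
  rw [Measure.map_add _ _ (by fun_prop), Measure.map_smul, Measure.map_smul,
    Measure.map_map (by fun_prop) (by fun_prop), gaussianMech, gaussianMech]
  congr 3
  funext z
  simp only [Function.comp_apply, smul_add, smul_inv_smul₀ hσ]
  abel

theorem norm_inv_smul_sq_le {E : Type*} [SeminormedAddCommGroup E] [NormedSpace ℝ E] (σ : ℝ)
    {v : E} (hv : ‖v‖ ≤ 1) : ‖σ⁻¹ • v‖ ^ 2 ≤ (σ ^ 2)⁻¹ := by
  rw [norm_smul, mul_pow, Real.norm_eq_abs, sq_abs, inv_pow]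
  exact mul_le_of_le_one_right (by positivity) (pow_le_one₀ (norm_nonneg v) hv)

variable {X : Type*} [DecidableEq X] {q : X → ℝ} {D : Finset X} {d : X} {α : ℕ}

theorem isProbabilityMeasure_poiSG (σ : ℝ) (hq : ∀ x ∈ D, q x ∈ Set.Icc (0 : ℝ) 1)
    (f : Finset X → EuclideanSpace ℝ (Fin n)) : IsProbabilityMeasure (poiSG σ q f D) :=
  isProbabilityMeasure_poissonMixture hq _

theorem momentBound_poiSG_insert (hσ : σ ≠ 0) (hα : 2 ≤ α) (hq : ∀ x, q x ∈ Set.Icc (0 : ℝ) 1)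
    {f : Finset X → EuclideanSpace ℝ (Fin n)} (hf : ∀ S, ‖f (insert d S) - f S‖ ≤ 1)
    (hd : d ∉ D) :
    MomentBound α (ENNReal.ofReal (poiSGMoment σ α (q d))) (poiSG σ q f (insert d D))
      (poiSG σ q f D) := by
  rw [poiSG, poiSG, sum_poissonWeight_insert (fun x _ => hq x) hd]
  refine .poissonMixture (by exact_mod_cast hα) (fun x _ => hq x) fun S _ => ?_
  rw [smul_gaussianMech_add_smul_gaussianMech hσ]
  exact (momentBound_gaussian_mixture hα (hq d) (norm_inv_smul_sq_le σ (hf S))).map (by fun_prop)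

theorem momentBound_poiSG_insert_symm (hσ : σ ≠ 0) (hα : 2 ≤ α)
    (hq : ∀ x, q x ∈ Set.Icc (0 : ℝ) 1) {f : Finset X → EuclideanSpace ℝ (Fin n)}
    (hf : ∀ S, ‖f (insert d S) - f S‖ ≤ 1) (hd : d ∉ D) :
    MomentBound α (ENNReal.ofReal (poiSGMoment σ α (q d))) (poiSG σ q f D)
      (poiSG σ q f (insert d D)) := by
  rw [poiSG, poiSG, sum_poissonWeight_insert (fun x _ => hq x) hd]
  refine .poissonMixture (by exact_mod_cast hα) (fun x _ => hq x) fun S _ => ?_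
  rw [smul_gaussianMech_add_smul_gaussianMech hσ]
  exact (momentBound_gaussian_mixture_symm hα (hq d) (norm_inv_smul_sq_le σ (hf S))).map
    (by fun_prop)

theorem measurable_map_of_measurable_uncurry {S T U : Type*} [MeasurableSpace S]
    [MeasurableSpace T] [MeasurableSpace U] {κ : S → Measure T} (hκ : Measurable κ)
    [∀ s, IsProbabilityMeasure (κ s)] {g : S → T → U} (hg : Measurable (Function.uncurry g)) :
    Measurable fun s => (κ s).map (g s) := by
  let η : Kernel S T := ⟨κ, hκ⟩
  have : IsMarkovKernel η := ⟨inferInstance⟩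
  convert ((Kernel.id ×ₖ η).map (Function.uncurry g)).measurable using 2 with s
  rw [Kernel.map_apply _ hg, Kernel.prod_apply, Kernel.id_apply, Measure.dirac_prod,
    Measure.map_map hg measurable_prodMk_left]
  rfl

theorem measurable_gaussianMech (σ : ℝ) :
    Measurable (gaussianMech σ : EuclideanSpace ℝ (Fin n) → Measure _) :=
  measurable_map_of_measurable_uncurry measurable_const
    (g := fun v z : EuclideanSpace ℝ (Fin n) => v + σ • z) (by fun_prop)

theorem measurable_poiSG {H : Type*} [MeasurableSpace H] (σ : ℝ) (q : X → ℝ) (D : Finset X)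
    {f : H → Finset X → EuclideanSpace ℝ (Fin n)} (hf : ∀ S, Measurable fun h => f h S) :
    Measurable fun h => poiSG σ q (f h) D := by
  refine Finset.measurable_sum _ fun S _ => Measure.measurable_of_measurable_coe _ fun s hs => ?_
  simp only [Measure.smul_apply, smul_eq_mul]
  exact ((Measure.measurable_coe hs).comp ((measurable_gaussianMech σ).comp (hf S))).const_mul _

theorem measurable_uncurry_snoc {E : Type*} [MeasurableSpace E] (r : ℕ) :
    Measurable (Function.uncurry fun (h : Fin r → E) (y : E) =>
      (Fin.snoc h y : Fin (r + 1) → E)) := by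
  refine measurable_pi_iff.2 fun j => ?_
  induction j using Fin.lastCases with
  | last => simpa [Function.uncurry_def] using measurable_snd
  | cast j =>
    simpa [Function.uncurry_def] using (measurable_pi_apply j).fun_comp measurable_fst

variable {f : (r : ℕ) → (Fin r → EuclideanSpace ℝ (Fin n)) → Finset X → EuclideanSpace ℝ (Fin n)}

theorem measurable_poiSGComp_step (σ : ℝ) (hq : ∀ x ∈ D, q x ∈ Set.Icc (0 : ℝ) 1)
    (hf : ∀ r S, Measurable fun h => f r h S) (r : ℕ) :
    Measurable fun h => (poiSG σ q (f r h) D).map fun y =>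
      (Fin.snoc h y : Fin (r + 1) → EuclideanSpace ℝ (Fin n)) := by
  have (h : Fin r → EuclideanSpace ℝ (Fin n)) := isProbabilityMeasure_poiSG σ hq (f r h)
  exact measurable_map_of_measurable_uncurry (measurable_poiSG σ q D (hf r))
    (measurable_uncurry_snoc r)

theorem isProbabilityMeasure_poiSGComp (σ : ℝ) (hq : ∀ x ∈ D, q x ∈ Set.Icc (0 : ℝ) 1)
    (hf : ∀ r S, Measurable fun h => f r h S) (τ : ℕ) :
    IsProbabilityMeasure (poiSGComp σ q f D τ) := by
  induction τ with
  | zero => exact Measure.dirac.isProbabilityMeasure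
  | succ r ih =>
    refine isProbabilityMeasure_bind (measurable_poiSGComp_step σ hq hf r).aemeasurable
      (.of_forall fun h => ?_)
    have := isProbabilityMeasure_poiSG σ hq (f r h)
    exact Measure.isProbabilityMeasure_map
      ((measurable_uncurry_snoc r).comp measurable_prodMk_left).aemeasurable

theorem momentBound_poiSGComp {α : ℝ} (hα : 1 < α) (hq : ∀ x, q x ∈ Set.Icc (0 : ℝ) 1)
    (hf : ∀ r S, Measurable fun h => f r h S) {C : ℝ≥0∞} {D' : Finset X}
    (h : ∀ r h, MomentBound α C (poiSG σ q (f r h) D) (poiSG σ q (f r h) D')) (τ : ℕ) :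
    MomentBound α (C ^ τ) (poiSGComp σ q f D τ) (poiSGComp σ q f D' τ) := by
  induction τ with
  | zero => simpa [poiSGComp] using MomentBound.refl hα _
  | succ r ih =>
    rw [pow_succ]
    exact ih.bind hα (measurable_poiSGComp_step σ (fun x _ => hq x) hf r)
      (measurable_poiSGComp_step σ (fun x _ => hq x) hf r) fun y =>
        (h r y).map ((measurable_uncurry_snoc r).comp measurable_prodMk_left)

theorem ofReal_exp_mul_natCast_mul_rhoPoiSG {q : ℝ} (hα : 2 ≤ α) (hq : q ∈ Set.Icc (0 : ℝ) 1)
    (σ : ℝ) (τ : ℕ) :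
    ENNReal.ofReal (Real.exp (((α : ℝ) - 1) * (τ * rhoPoiSG σ α q))) =
      ENNReal.ofReal (poiSGMoment σ α q) ^ τ := by
  rw [← exp_mul_rhoPoiSG hα hq, ← ENNReal.ofReal_pow (Real.exp_pos _).le, ← Real.exp_nat_mul,
    mul_left_comm]

theorem isRDP_poiSGComp (hσ : σ ≠ 0) (hα : 2 ≤ α) (hq : ∀ x, q x ∈ Set.Icc (0 : ℝ) 1)
    (hf : ∀ r S, Measurable fun h => f r h S)
    (hs : ∀ r h S, ‖f r h (insert d S) - f r h S‖ ≤ 1) (τ : ℕ) :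
    IsRDP (LocalAdj d) α (τ * rhoPoiSG σ α (q d)) fun D => poiSGComp σ q f D τ := by
  have hα' : (1 : ℝ) < α := by exact_mod_cast hα
  have (D : Finset X) := isProbabilityMeasure_poiSGComp σ (fun x (_ : x ∈ D) => hq x) hf τ
  rw [isRDP_iff_momentBound hα', ofReal_exp_mul_natCast_mul_rhoPoiSG hα (hq d)]
  rintro D D' ⟨hd, rfl⟩
  obtain ⟨D, hdD, rfl⟩ : ∃ D₀, d ∉ D₀ ∧ insert d D₀ = D :=
    ⟨D.erase d, D.notMem_erase d, Finset.insert_erase hd⟩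
  rw [Finset.erase_insert hdD]
  exact ⟨momentBound_poiSGComp hα' hq hf
      (fun r h => momentBound_poiSG_insert hσ hα hq (hs r h) hdD) τ,
    momentBound_poiSGComp hα' hq hf
      (fun r h => momentBound_poiSG_insert_symm hσ hα hq (hs r h) hdD) τ⟩

end

/-! ### Client sampling -/

section

variable {lam α ρ : ℝ}

theorem ofReal_exp_mul_rhoAmp (hlam : lam ∈ Set.Icc (0 : ℝ) 1) (hα : α ≠ 1) (ρ : ℝ) :
    ENNReal.ofReal (Real.exp ((α - 1) * rhoAmp lam α ρ)) =
      ENNReal.ofReal (1 - lam) +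
        ENNReal.ofReal lam * ENNReal.ofReal (Real.exp ((α - 1) * ρ)) := by
  rw [rhoAmp, ← mul_assoc, mul_one_div_cancel (sub_ne_zero.2 hα), one_mul,
    Real.exp_log (one_sub_add_mul_pos hlam (Real.exp_pos _)), ← ENNReal.ofReal_mul hlam.1,
    ENNReal.ofReal_add (sub_nonneg.2 hlam.2) (mul_nonneg hlam.1 (Real.exp_pos _).le)]

variable {ι X V : Type*} [AddCommGroup V] [Module ℝ V] [MeasurableSpace V]

theorem measurable_clientAvg [MeasurableAdd₂ V] [MeasurableConstSMul ℝ V] (x : V) (ω : Finset ι) :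
    Measurable (clientAvg x ω) := by
  unfold clientAvg
  split_ifs <;> fun_prop

variable [Fintype ι] [DecidableEq ι] {A : ι → Finset X → V → Measure V} {x : V}

theorem globalRound_eq_sum_powerset (lam : ℝ) (A : ι → Finset X → V → Measure V) (x : V)
    (𝒟 : ι → Finset X) :
    globalRound lam A x 𝒟 = ∑ ω ∈ (Finset.univ : Finset ι).powerset,
      ENNReal.ofReal (poissonWeight (fun _ => lam) Finset.univ ω) •
        (Measure.pi fun k : ω => A k (𝒟 k) x).map (clientAvg x ω) := by
  rw [globalRound, Finset.powerset_univ]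

variable [MeasurableAdd₂ V] [MeasurableConstSMul ℝ V] [∀ k D, IsProbabilityMeasure (A k D x)]

theorem isProbabilityMeasure_globalRound (hlam : lam ∈ Set.Icc (0 : ℝ) 1) (𝒟 : ι → Finset X) :
    IsProbabilityMeasure (globalRound lam A x 𝒟) := by
  have (ω : Finset ι) := Measure.isProbabilityMeasure_map
    (μ := Measure.pi fun k : ω => A k (𝒟 k) x) (measurable_clientAvg x ω).aemeasurable
  rw [globalRound_eq_sum_powerset]
  exact isProbabilityMeasure_poissonMixture (fun _ _ => hlam) _

theorem momentBound_globalRound (hα : 1 < α) (hlam : lam ∈ Set.Icc (0 : ℝ) 1)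
    {𝒟 𝒟' : ι → Finset X} {i : ι} {C : ℝ≥0∞}
    (hi : MomentBound α C (A i (𝒟 i) x) (A i (𝒟' i) x)) (hne : ∀ k ≠ i, 𝒟 k = 𝒟' k) :
    MomentBound α (ENNReal.ofReal (1 - lam) + ENNReal.ofReal lam * C) (globalRound lam A x 𝒟)
      (globalRound lam A x 𝒟') := by
  rw [globalRound_eq_sum_powerset, globalRound_eq_sum_powerset,
    ← mul_one (ENNReal.ofReal (1 - lam)),
    ← sum_poissonWeight_mul_ite (q := fun _ => lam) (fun _ _ => hlam) (Finset.mem_univ i)]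
  refine .sum hα _ _ _ fun ω _ => .map ?_ (measurable_clientAvg x ω)
  split_ifs with hiω
  · exact .pi hα (k := ⟨i, hiω⟩) hi fun k hk => by
      rw [hne k fun h => hk (Subtype.ext h)]
  · have heq : (fun k : ω => A k (𝒟 k) x) = fun k : ω => A k (𝒟' k) x :=
      funext fun k => by rw [hne k (ne_of_mem_of_not_mem k.2 hiω)]
    rw [heq]
    exact .refl hα _

theorem IsRDP.globalRound [DecidableEq X] (hα : 1 < α) (hlam : lam ∈ Set.Icc (0 : ℝ) 1) {i : ι}
    {d : X} (h : IsRDP (LocalAdj d) α ρ fun D => A i D x) :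
    IsRDP (FedAdj i d) α (rhoAmp lam α ρ) (globalRound lam A x) := by
  have (𝒟 : ι → Finset X) := isProbabilityMeasure_globalRound (A := A) (x := x) hlam 𝒟
  rw [isRDP_iff_momentBound hα] at h ⊢
  rw [ofReal_exp_mul_rhoAmp hlam hα.ne']
  rintro 𝒟 _ ⟨hd, rfl⟩
  obtain ⟨hle, hge⟩ := h (𝒟 i) ((𝒟 i).erase d) ⟨hd, rfl⟩
  exact ⟨momentBound_globalRound hα hlam (i := i) (by simpa using hle) (by simp +contextual),
    momentBound_globalRound hα hlam (i := i) (by simpa using hge) (by simp +contextual)⟩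

end

theorem mainTheorem2_general
    {ι : Type*} [Fintype ι] [DecidableEq ι] {X : Type*} [DecidableEq X] {n : ℕ}
    {V : Type*} [AddCommGroup V] [Module ℝ V] [MeasurableSpace V] [MeasurableAdd₂ V]
    [MeasurableConstSMul ℝ V]
    (lam : ℝ) (hlam : lam ∈ Set.Icc (0 : ℝ) 1)
    (q : ι → X → ℝ) (hq : ∀ i x, q i x ∈ Set.Icc (0 : ℝ) 1)
    (i : ι) (d : X) (x : V) :
    (∀ A : ι → Finset X → V → Measure V, (∀ k D, IsProbabilityMeasure (A k D x)) →
      ∀ α : ℝ, 1 < α → ∀ ρ : ℝ,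
        IsRDP (LocalAdj d) α ρ (fun D => A i D x) →
        IsRDP (FedAdj i d) α (rhoAmp lam α ρ) (globalRound lam A x)) ∧
    (∀ σ : ℝ, σ ≠ 0 → ∀ τ : ℕ,
      ∀ f : ι → V → (r : ℕ) → (Fin r → EuclideanSpace ℝ (Fin n)) → Finset X →
          EuclideanSpace ℝ (Fin n),
        (∀ k r S, Measurable fun h => f k x r h S) →
        (∀ r h S, ‖f i x r h (insert d S) - f i x r h S‖ ≤ 1) →
        ∀ α : ℕ, 2 ≤ α →
          IsRDP (LocalAdj d) α (τ * rhoPoiSG σ α (q i d))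
            (fun D => poiSGComp σ (q i) (f i x) D τ) ∧
          ∀ g : ι → V → (Fin τ → EuclideanSpace ℝ (Fin n)) → V,
            (∀ k, Measurable (g k x)) →
            IsRDP (FedAdj i d) α (rhoAmp lam α (τ * rhoPoiSG σ α (q i d)))
              (globalRound lam
                (fun k D y => (poiSGComp σ (q k) (f k y) D τ).map (g k y)) x)) := by
  refine ⟨fun A hA α hα ρ h => h.globalRound hα hlam, fun σ hσ τ f hf hs α hα => ?_⟩
  have hlocal := isRDP_poiSGComp hσ hα (hq i) (hf i) hs τ
  refine ⟨hlocal, fun g hg => ?_⟩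
  have hα' : (1 : ℝ) < α := by exact_mod_cast hα
  have (k : ι) (D : Finset X) : IsProbabilityMeasure (poiSGComp σ (q k) (f k x) D τ) :=
    isProbabilityMeasure_poiSGComp σ (fun y _ => hq k y) (hf k) τ
  have (k : ι) (D : Finset X) :
      IsProbabilityMeasure ((poiSGComp σ (q k) (f k x) D τ).map (g k x)) :=
    Measure.isProbabilityMeasure_map (hg k).aemeasurable
  exact (hlocal.map hα' (hg i)).globalRound hα' hlam

theorem mainTheorem2
    -- clients, records, dimension of one step, space of model parameters
    {ι : Type*} [Fintype ι] [DecidableEq ι] {X : Type*} [DecidableEq X] {n : ℕ}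
    {V : Type*} [NormedAddCommGroup V] [NormedSpace ℝ V] [MeasurableSpace V] [BorelSpace V]
    [SecondCountableTopology V]
    -- client sampling probability, record sampling probabilities
    (lam : ℝ) (hlam : lam ∈ Set.Ioc (0 : ℝ) 1)
    (q : ι → X → ℝ) (hq : ∀ i x, q i x ∈ Set.Ioc (0 : ℝ) 1)
    -- the target record `d` of client `i` and the current global model `x`
    (i : ι) (d : X) (x : V) :
    -- amplification by client sampling, for arbitrary local algorithms
    (∀ A : ι → Finset X → V → Measure V, (∀ k D y, IsProbabilityMeasure (A k D y)) →
      ∀ α : ℝ, 1 < α → ∀ ρ : ℝ,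
        IsRDP (LocalAdj d) α ρ (fun D => A i D x) →
        IsRDP (FedAdj i d) α (rhoAmp lam α ρ) (globalRound lam A x)) ∧
    -- the local multi-step update with noise level `σ` and `τ` steps, and the resulting bound on
    -- the whole round when client `k` uploads a data-independent function of its `τ` outputs
    (∀ σ : ℝ, 0 < σ → ∀ τ : ℕ,
      ∀ f : ι → V → (r : ℕ) → (Fin r → EuclideanSpace ℝ (Fin n)) → Finset X →
          EuclideanSpace ℝ (Fin n),
        (∀ k y r S, Measurable fun h => f k y r h S) →
        (∀ k y r h S c, ‖f k y r h (insert c S) - f k y r h S‖ ≤ 1) →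
        ∀ α : ℕ, 2 ≤ α →
          IsRDP (LocalAdj d) α (τ * rhoPoiSG σ α (q i d))
            (fun D => poiSGComp σ (q i) (f i x) D τ) ∧
          ∀ g : ι → V → (Fin τ → EuclideanSpace ℝ (Fin n)) → V,
            (∀ k y, Measurable (g k y)) →
            IsRDP (FedAdj i d) α (rhoAmp lam α (τ * rhoPoiSG σ α (q i d)))
              (globalRound lam
                (fun k D y => (poiSGComp σ (q k) (f k y) D τ).map (g k y)) x)) :=
  (mainTheorem2_general lam (Set.Ioc_subset_Icc_self hlam) q
    (fun k y => Set.Ioc_subset_Icc_self (hq k y)) i d x).imp (fun h A hA => h A (hA · · x))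
    fun h σ hσ τ f hf hs α hα => (h σ hσ.ne' τ f (hf · x) (hs i x · · · d) α hα).imp_right
      fun hround g hg => hround g (hg · x)
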